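/- Let $p$ be an odd prime and let $a=\varepsilon\prod_{j=1}^m q_j^{e_j}$ be an integer, where $\varepsilon\in\{1,-1\}$, $q_1,\dots,q_m$ are distinct primes and $1\le e_j\le p-1$, such that $X^p-a$ is irreducible over $\mathbb Z$ (equivalently, $m\ge 1$). Let $K=\mathbb Q(\alpha)$ with $\alpha^p=a$, and let $\mathcal O_K$ be its ring of integers. Let $\alpha_1,\dots,\alpha_m$ be elements of an extension field of $K$ with $\alpha_j^p=q_j$ and $\alpha=\varepsilon\prod_{j=1}^m\alpha_j^{e_j}$. Call $p$ a Wieferich prime to base $a$ if $p^2$ divides $a^{p-1}-1$. Then the following holds. (i) For $0\le k\le p-1$ and $1\le j\le m$ there are integers $t_{kj}\ge 0$ and $0\le e'_{kj}\le p-1$ such that $k e_j=p\,t_{kj}+e'_{kj}$ and $$\frac{\alpha^k}{\prod_{j=1}^m q_j^{t_{kj}}}=\varepsilon^k\prod_{j=1}^m\alpha_j^{e'_{kj}}\in\mathcal O_K .$$ If $k=0$ then $t_{kj}=e'_{kj}=0$; otherwise $e'_{kj}\ge 1$. (The numbers $t_{kj}$ and $e'_{kj}$ do not depend on the choice of the $\alpha_j$.)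 (ii) For $1\le j\le m$ one has $t_{k+1,j}\ge t_{kj}$ for $1\le k\le p-2$, and $(p-1-k)e_j\ge t_{p-1,j}-t_{kj}$ for $1\le k\le p-1$. (iii) If $p$ is not a Wieferich prime to base $a$, then the elements $\dfrac{\alpha^k}{\prod_{j=1}^m q_j^{t_{kj}}}$, $0\le k\le p-1$, form a $\mathbb Z$-basis of $\mathcal O_K$. (iv) If $p$ is a Wieferich prime to base $a$, then the elements $\dfrac{\alpha^k}{\prod_{j=1}^m q_j^{t_{kj}}}$, $0\le k\le p-2$, together with $\dfrac{(\alpha-a)^{p-1}}{p\prod_{j=1}^m q_j^{t_{p-1,j}}}$, form a $\mathbb Z$-basis of $\mathcal O_K$. -/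

import Mathlib

open scoped NumberField

/-- `q` is a Wieferich prime to base `r`: `q` is prime and `q ^ 2` divides `r ^ (q - 1) - 1`. -/
def IsWieferichPrime (q : ℕ) (r : ℤ) : Prop :=
  q.Prime ∧ (q : ℤ) ^ 2 ∣ r ^ (q - 1) - 1

/-! Write b_k for α^k / ∏ q_j^{t_kj}. Its p-th power is ε^k ∏ q_j^{k e_j mod p}, so it is integral.
Traces against powers of α put p·a·x in ℤ[α] for every integral x (`exists_prime_mul_eq_sum`); it
remains to remove the factor p·a one prime at a time. At a prime above q_j the b_k have pairwise
distinct fractional valuations, so nothing cancels and q_j divides out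
(`Valuation.dvd_of_map_sum_le`).

If p ∤ a, the factor p is treated through β = α - a, which satisfies β^p = -pβu - (a^p - a) with
v(u) = 1 for v above p. When p² ∤ a^p - a this is Eisenstein-like: v(β)^p = v(p), and the same
argument works with powers of β. When p² ∣ a^p - a, every v above p has v(β) ≤ v(p) or v(β)^(p-1) =
v(p), so β^(p-1)/p is integral; a trace computation shows that the second alternative occurs for
some v. Subtracting a multiple of the new basis element leaves p - 1 terms, which that single v
controls. -/

open IsDedekindDomain

/-! ### Multiplicative valuations and integral combinations -/

section Valuation

variable {K Γ₀ : Type*} [Field K] [LinearOrderedCommGroupWithZero Γ₀] (v : Valuation K Γ₀)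

theorem Valuation.le_one_of_isIntegral {x : K} (hx : IsIntegral ℤ x) : v x ≤ 1 :=
  (Valuation.integer.integers v).mem_of_integral
    (hx.tower_top (A := v.integer))

theorem Valuation.intCast_le_one (n : ℤ) : v (n : K) ≤ 1 :=
  v.le_one_of_isIntegral (by simpa using isIntegral_algebraMap (R := ℤ) (A := K) (x := n))

theorem Valuation.intCast_le_of_dvd {m n : ℤ} (h : m ∣ n) : v (n : K) ≤ v (m : K) := by
  obtain ⟨c, rfl⟩ := h
  push_cast
  rw [map_mul]
  exact mul_le_of_le_one_right' (v.intCast_le_one c)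

theorem Valuation.intCast_eq_one_of_not_dvd {ℓ : ℕ} (hℓ : ℓ.Prime) (hv : v (ℓ : K) < 1)
    {n : ℤ} (hn : ¬ (ℓ : ℤ) ∣ n) : v (n : K) = 1 := by
  refine le_antisymm (v.intCast_le_one n) ?_
  by_contra! hlt
  obtain ⟨x, y, hxy⟩ := (Nat.prime_iff_prime_int.mp hℓ).coprime_iff_not_dvd.mpr hn
  have h1 : v (((x * ℓ + y * n : ℤ)) : K) < 1 := by
    push_cast
    refine v.map_add_lt ?_ ?_ <;> rw [map_mul]
    · exact mul_lt_one_of_nonneg_of_lt_one_right (v.intCast_le_one x) zero_le hv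
    · exact mul_lt_one_of_nonneg_of_lt_one_right (v.intCast_le_one y) zero_le hlt
  rw [hxy] at h1
  simp at h1

/-- If the terms `y i` have pairwise distinct fractional valuations with respect to `ℓ`, then an
integral combination of them is divisible by `ℓ` only if all its coefficients are. -/
theorem Valuation.dvd_of_map_sum_le {ℓ : ℕ} (hℓ : ℓ.Prime) (h0 : v (ℓ : K) ≠ 0)
    (hv : v (ℓ : K) < 1) {ι : Type*} {s : Finset ι} {n : ι → ℤ} {y : ι → K} {f : ι → ℕ} {N : ℕ}
    (hf : ∀ i ∈ s, f i < N) (hinj : Set.InjOn f s)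
    (hy : ∀ i ∈ s, v (y i) ^ N = v (ℓ : K) ^ f i)
    (hsum : v (∑ i ∈ s, (n i : K) * y i) ≤ v (ℓ : K)) : ∀ i ∈ s, (ℓ : ℤ) ∣ n i := by
  classical
  by_contra! hex
  obtain ⟨i₁, hi₁, hn₁⟩ := hex
  have hpos : 0 < v (ℓ : K) := zero_lt_iff.mpr h0
  -- The term with least `f` among those with coefficient prime to ℓ strictly dominates: a
  -- coefficient divisible by ℓ contributes at least the exponent `N`, which exceeds `f i`.
  obtain ⟨i, hi, hmin⟩ := Finset.exists_min_image (s.filter fun i => ¬ (ℓ : ℤ) ∣ n i) f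
    ⟨i₁, by simp [hi₁, hn₁]⟩
  simp only [Finset.mem_filter] at hi hmin
  have hN : N ≠ 0 := (Nat.zero_le _).trans_lt (hf i hi.1) |>.ne'
  have hvi : v ((n i : K) * y i) = v (y i) := by
    rw [map_mul, v.intCast_eq_one_of_not_dvd hℓ hv hi.2, one_mul]
  have hlt : ∀ k ∈ s \ {i}, v ((n k : K) * y k) < v ((n i : K) * y i) := by
    intro k hk
    simp only [Finset.mem_sdiff, Finset.mem_singleton] at hk
    rw [hvi]
    refine lt_of_pow_lt_pow_left₀ N zero_le ?_
    rw [map_mul, mul_pow, hy k hk.1, hy i hi.1]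
    by_cases hd : (ℓ : ℤ) ∣ n k
    · have h1 : v (n k : K) ≤ v (ℓ : K) := by simpa using v.intCast_le_of_dvd hd
      calc v (n k : K) ^ N * v (ℓ : K) ^ f k ≤ v (ℓ : K) ^ N * 1 :=
            mul_le_mul' (pow_le_pow_left₀ zero_le h1 N) (pow_le_one₀ zero_le hv.le)
        _ = v (ℓ : K) ^ N := mul_one _
        _ < v (ℓ : K) ^ f i := pow_lt_pow_right_of_lt_one₀ hpos hv (hf i hi.1)
    · rw [v.intCast_eq_one_of_not_dvd hℓ hv hd, one_pow, one_mul]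
      refine pow_lt_pow_right_of_lt_one₀ hpos hv ((hmin k ⟨hk.1, hd⟩).lt_of_ne ?_)
      exact fun h => hk.2 (hinj hk.1 hi.1 h.symm)
  rw [v.map_sum_eq_of_lt hi.1 hlt, hvi] at hsum
  have := pow_le_pow_left₀ zero_le hsum N
  rw [hy i hi.1] at this
  exact absurd (pow_lt_pow_right_of_lt_one₀ hpos hv (hf i hi.1)) this.not_gt

end Valuation

/-! ### Primes and integral bases of a number field -/

section NumberField

variable {K : Type*} [Field K] [NumberField K]

theorem exists_valuation_lt_one {ℓ : ℕ} (hℓ : ℓ.Prime) :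
    ∃ v : HeightOneSpectrum (𝓞 K), v.valuation K (ℓ : K) < 1 := by
  have hu : ¬ IsUnit ((ℓ : ℕ) : 𝓞 K) := by
    intro h
    have h2 : IsIntegral ℤ ((ℓ : ℚ)⁻¹) := by
      have h3 : IsIntegral ℤ (algebraMap ℚ K ((ℓ : ℚ)⁻¹)) := by
        obtain ⟨u, hu⟩ := h.exists_right_inv
        have h4 : (ℓ : K) * (u : K) = 1 := by
          have := congrArg (algebraMap (𝓞 K) K) hu
          simpa using this
        have h5 : algebraMap ℚ K ((ℓ : ℚ)⁻¹) = (u : K) := by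
          simpa using (eq_inv_of_mul_eq_one_right h4).symm
        rw [h5]
        exact u.isIntegral_coe
      exact (isIntegral_algebraMap_iff (algebraMap ℚ K).injective).mp h3
    obtain ⟨z, hz⟩ := IsIntegrallyClosed.isIntegral_iff.mp h2
    have hz' : (z : ℚ) * ℓ = 1 := by
      rw [← eq_intCast (algebraMap ℤ ℚ) z, hz]
      exact inv_mul_cancel₀ (by exact_mod_cast hℓ.ne_zero)
    have hz2 : z * (ℓ : ℤ) = 1 := by exact_mod_cast hz'
    exact (Nat.prime_iff_prime_int.mp hℓ).not_isUnit (IsUnit.of_mul_eq_one_right _ hz2)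
  obtain ⟨M, hM, hle⟩ := Ideal.exists_le_maximal (Ideal.span {((ℓ : ℕ) : 𝓞 K)})
    (by rwa [Ne, Ideal.span_singleton_eq_top])
  have hmem : ((ℓ : ℕ) : 𝓞 K) ∈ M := hle (Ideal.mem_span_singleton_self _)
  refine ⟨⟨M, hM.isPrime, fun h => ?_⟩, ?_⟩
  · rw [h, Ideal.mem_bot] at hmem
    exact hℓ.ne_zero (by exact_mod_cast hmem)
  · have := (HeightOneSpectrum.valuation_lt_one_iff_mem (K := K)
      ⟨M, hM.isPrime, fun h => hℓ.ne_zero (by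
        rw [h, Ideal.mem_bot] at hmem; exact_mod_cast hmem)⟩ ((ℓ : ℕ) : 𝓞 K)).mpr hmem
    simpa using this

theorem isIntegral_of_valuation_le_one {x : K}
    (h : ∀ v : HeightOneSpectrum (𝓞 K), v.valuation K x ≤ 1) : IsIntegral ℤ x := by
  obtain ⟨y, rfl⟩ := HeightOneSpectrum.mem_integers_of_valuation_le_one K x h
  exact y.isIntegral_coe

/-- A family of algebraic integers whose length is the degree and which spans all algebraic
integers over `ℤ` is an integral basis. -/
theorem exists_basis_of_isIntegral_mem_span {n : ℕ} (hn : Module.finrank ℚ K = n) {b : Fin n → K}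
    (hb : ∀ i, IsIntegral ℤ (b i))
    (hspan : ∀ x : K, IsIntegral ℤ x → x ∈ Submodule.span ℤ (Set.range b)) :
    ∃ B : Module.Basis (Fin n) ℤ (𝓞 K), ∀ k, (B k : K) = b k := by
  -- Every element of K has a nonzero integer multiple that is integral, so `b` spans over ℚ;
  -- counting then gives independence.
  have htop : ⊤ ≤ Submodule.span ℚ (Set.range b) := by
    intro x _
    obtain ⟨y, hy, h⟩ := ((IsFractionRing.isAlgebraic_iff ℤ ℚ K).mpr
      (Algebra.IsAlgebraic.isAlgebraic (R := ℚ) x)).exists_integral_multiple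
    have h1 : y • x ∈ Submodule.span ℚ (Set.range b) :=
      Submodule.span_subset_span ℤ ℚ _ (hspan _ h)
    have h2 := Submodule.smul_mem _ ((y : ℚ)⁻¹) h1
    rwa [← Int.cast_smul_eq_zsmul ℚ, smul_smul, inv_mul_cancel₀ (by exact_mod_cast hy),
      one_smul] at h2
  have hli : LinearIndependent ℚ b :=
    linearIndependent_of_top_le_span_of_card_eq_finrank htop (by simp [hn])
  let c : Fin n → 𝓞 K := fun i => ⟨b i, hb i⟩
  have hcb : (Algebra.linearMap (𝓞 K) K).restrictScalars ℤ ∘ c = b := rfl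
  have hli' : LinearIndependent ℤ c := by
    refine LinearIndependent.of_comp ((Algebra.linearMap (𝓞 K) K).restrictScalars ℤ) ?_
    rw [hcb]
    exact hli.restrict_scalars (R := ℤ) (by
      intro x y h
      simpa using h)
  have hsp : ⊤ ≤ Submodule.span ℤ (Set.range c) := by
    intro x _
    have h1 := hspan x x.isIntegral_coe
    rw [← hcb, Set.range_comp, ← Submodule.map_span] at h1
    obtain ⟨y, hy, hyx⟩ := h1
    rwa [← NumberField.RingOfIntegers.coe_injective (K := K) hyx]
  exact ⟨Module.Basis.mk hli' hsp, fun k => by rw [Module.Basis.mk_apply]; rfl⟩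

end NumberField

/-! ### Traces and denominators in a pure extension of degree p -/

section PureRadical

variable {K : Type*} [Field K] [NumberField K] {p : ℕ} {a : ℤ} {α : K}

theorem finrank_of_pow_eq (hp : p ≠ 0)
    (hirr : Irreducible (Polynomial.X ^ p - Polynomial.C a : Polynomial ℤ))
    (hα : α ^ p = (a : K)) (hK : IntermediateField.adjoin ℚ {α} = ⊤) :
    Module.finrank ℚ K = p := by
  have hirr' : Irreducible (Polynomial.X ^ p - Polynomial.C (a : ℚ) : Polynomial ℚ) := by
    have := ((Polynomial.monic_X_pow_sub_C a hp).irreducible_iff_irreducible_map_fraction_map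
      (K := ℚ)).mp hirr
    simpa using this
  have hmin : minpoly ℚ α = Polynomial.X ^ p - Polynomial.C (a : ℚ) :=
    (minpoly.eq_of_irreducible_of_monic hirr' (by simp [hα])
      (Polynomial.monic_X_pow_sub_C _ hp)).symm
  have h := IntermediateField.adjoin.finrank (Algebra.IsIntegral.isIntegral (R := ℚ) α)
  rw [hK, IntermediateField.finrank_top', hmin, Polynomial.natDegree_X_pow_sub_C] at h
  exact h

theorem exists_basis_pow (hp : p ≠ 0)
    (hirr : Irreducible (Polynomial.X ^ p - Polynomial.C a : Polynomial ℤ))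
    (hα : α ^ p = (a : K)) (hK : IntermediateField.adjoin ℚ {α} = ⊤) :
    ∃ B : Module.Basis (Fin p) ℚ K, ∀ i, B i = α ^ (i : ℕ) := by
  have hfin := finrank_of_pow_eq hp hirr hα hK
  have hint := Algebra.IsIntegral.isIntegral (R := ℚ) α
  have hdeg : (minpoly ℚ α).natDegree = p := by
    rw [← IntermediateField.adjoin.finrank hint, hK, IntermediateField.finrank_top', hfin]
  have hli := linearIndependent_pow (K := ℚ) α
  rw [hdeg] at hli
  have : Nonempty (Fin p) := ⟨⟨0, Nat.pos_of_ne_zero hp⟩⟩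
  exact ⟨basisOfLinearIndependentOfCardEqFinrank hli (by simp [hfin]), fun i => by simp⟩

/-- Multiplication by α^n sends α^i to a multiple of α^((n+i) mod p), a different basis vector, so
the diagonal of its matrix vanishes. -/
theorem trace_pow_eq_zero (hp : p ≠ 0)
    (hirr : Irreducible (Polynomial.X ^ p - Polynomial.C a : Polynomial ℤ))
    (hα : α ^ p = (a : K)) (hK : IntermediateField.adjoin ℚ {α} = ⊤) {n : ℕ} (hn : ¬ p ∣ n) :
    Algebra.trace ℚ K (α ^ n) = 0 := by
  obtain ⟨B, hB⟩ := exists_basis_pow hp hirr hα hK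
  rw [Algebra.trace_eq_matrix_trace B, Matrix.trace]
  refine Finset.sum_eq_zero fun i _ => ?_
  rw [Matrix.diag_apply, Algebra.leftMulMatrix_eq_repr_mul, hB, ← pow_add,
    ← Nat.div_add_mod (n + i) p, pow_add, pow_mul, hα]
  have hlt : (n + i) % p < p := Nat.mod_lt _ (Nat.pos_of_ne_zero hp)
  have hne : (⟨(n + i) % p, hlt⟩ : Fin p) ≠ i := by
    intro h
    have h1 : (n + i) % p = i := congrArg Fin.val h
    refine hn ((Nat.modEq_zero_iff_dvd).mp (Nat.ModEq.add_right_cancel' (i : ℕ) ?_))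
    rw [Nat.ModEq, h1, zero_add, Nat.mod_eq_of_lt i.2]
  have h2 : ((a : K) ^ ((n + i) / p) * α ^ ((n + i) % p)) =
      ((a : ℚ) ^ ((n + i) / p)) • B ⟨(n + i) % p, hlt⟩ := by
    rw [hB, Algebra.smul_def]
    simp
  rw [h2, map_smul, B.repr_self, Finsupp.smul_apply, Finsupp.single_eq_of_ne hne.symm, smul_zero]

theorem trace_intCast_mul (n : ℤ) (x : K) :
    Algebra.trace ℚ K ((n : K) * x) = n * Algebra.trace ℚ K x := by
  have : ((n : K) * x) = (n : ℚ) • x := by rw [Algebra.smul_def]; simp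
  rw [this, map_smul, smul_eq_mul]

theorem trace_intCast (hfin : Module.finrank ℚ K = p) (n : ℤ) :
    Algebra.trace ℚ K (n : K) = p * n := by
  have := Algebra.trace_algebraMap (R := ℚ) (S := K) (n : ℚ)
  rw [hfin] at this
  simpa using this

theorem exists_intCast_eq_trace {x : K} (hx : IsIntegral ℤ x) :
    ∃ n : ℤ, (n : ℚ) = Algebra.trace ℚ K x :=
  IsIntegrallyClosed.isIntegral_iff.mp (Algebra.isIntegral_trace (L := ℚ) hx)

theorem isIntegral_of_pow_eq {K : Type*} [Field K] {α : K} (hp : p ≠ 0) (hα : α ^ p = (a : K)) :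
    IsIntegral ℤ α :=
  IsIntegral.of_pow (Nat.pos_of_ne_zero hp)
    (by rw [hα]; simpa using isIntegral_algebraMap (R := ℤ) (A := K) (x := a))

/-- The discriminant of the powers of a `p`-th root of `a` bounds denominators: `p * a` times an
algebraic integer is an integral combination of the powers of the root. -/
theorem exists_prime_mul_eq_sum (hp : p ≠ 0)
    (hirr : Irreducible (Polynomial.X ^ p - Polynomial.C a : Polynomial ℤ))
    (hα : α ^ p = (a : K)) (hK : IntermediateField.adjoin ℚ {α} = ⊤) {x : K}
    (hx : IsIntegral ℤ x) :
    ∃ n : ℕ → ℤ, (a : K) * (p * x) = ∑ k ∈ Finset.range p, (n k : K) * α ^ k := by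
  obtain ⟨B, hB⟩ := exists_basis_pow hp hirr hα hK
  have hfin := finrank_of_pow_eq hp hirr hα hK
  have hαi := isIntegral_of_pow_eq hp hα
  -- Up to the factor p·a, the α^(p-k) are dual to the α^k under the trace form, so these integer
  -- traces are p·a times the coordinates of x.
  choose n hn using fun k : ℕ => exists_intCast_eq_trace (hx.mul (hαi.pow (p - k)))
  refine ⟨n, ?_⟩
  have hxs : x = ∑ i : Fin p, (B.repr x i) • α ^ (i : ℕ) := by
    conv_lhs => rw [← B.sum_repr x]
    simp [hB]
  have key : ∀ k : Fin p, (n k : ℚ) = p * a * B.repr x k := by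
    intro k
    rw [hn]
    conv_lhs => rw [hxs, Finset.sum_mul, map_sum]
    rw [Finset.sum_eq_single k]
    · rw [smul_mul_assoc, map_smul, ← pow_add, Nat.add_sub_cancel' k.2.le, hα,
        trace_intCast hfin, smul_eq_mul]
      ring
    · intro i _ hik
      rw [smul_mul_assoc, map_smul, ← pow_add, trace_pow_eq_zero hp hirr hα hK, smul_zero]
      intro hd
      refine hik (Fin.ext ?_)
      obtain ⟨c, hc⟩ := hd
      have hi := i.2
      have hk := k.2
      have h1 : c = 1 := by
        have h0 : c ≠ 0 := by rintro rfl; omega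
        have h2 : c < 2 := by
          by_contra! h
          have := Nat.mul_le_mul_left p h
          omega
        omega
      subst h1
      omega
    · simp
  rw [Finset.sum_range]
  conv_lhs => rw [hxs]
  rw [Finset.mul_sum, Finset.mul_sum]
  refine Finset.sum_congr rfl fun i _ => ?_
  have : (n i : K) = algebraMap ℚ K (p * a * B.repr x i) := by rw [← key i]; simp
  rw [this, Algebra.smul_def]
  simp only [map_mul, map_natCast, map_intCast]
  ring

/-- If `v` takes the values `v (p) ^ (k / N)` on the powers of `α - a`, then divisibility by `p` of
an integral combination of `N` powers of `α` is detected by `v`. -/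
theorem Valuation.dvd_of_map_sum_pow_le {Γ₀ : Type*} [LinearOrderedCommGroupWithZero Γ₀]
    (v : Valuation K Γ₀) (hp : p.Prime) (hv : v (p : K) < 1) {N : ℕ}
    (hβ : v (α - a) ^ N = v (p : K)) {n : ℕ → ℤ}
    (hsum : v (∑ k ∈ Finset.range N, (n k : K) * α ^ k) ≤ v (p : K)) :
    ∀ k < N, (p : ℤ) ∣ n k := by
  classical
  have h0 : v (p : K) ≠ 0 := (v.ne_zero_iff).mpr (by exact_mod_cast hp.ne_zero)
  let f : Polynomial ℤ := ∑ k ∈ Finset.range N, Polynomial.C (n k) * Polynomial.X ^ k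
  have hfc : ∀ k < N, f.coeff k = n k := by
    intro k hk
    simp [f, Polynomial.coeff_X_pow, hk]
  have hfdeg : f.degree < N := by
    refine (Polynomial.degree_sum_le _ _).trans_lt ?_
    refine (Finset.sup_lt_iff (by simp)).mpr fun k hk => ?_
    refine (Polynomial.degree_C_mul_X_pow_le _ _).trans_lt ?_
    exact_mod_cast Finset.mem_range.mp hk
  -- The Taylor shift rewrites the sum in powers of α - a. It is invertible over ℤ, so divisibility
  -- of the coefficients carries back to `f`.
  let g := Polynomial.taylor a f
  have hgdeg : g.degree < N := by rwa [Polynomial.degree_taylor]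
  have hge : Polynomial.aeval (α - a) g = ∑ k ∈ Finset.range N, (n k : K) * α ^ k := by
    simp [g, f, Polynomial.taylor_apply]
  have hgs : Polynomial.aeval (α - a) g =
      ∑ k ∈ Finset.range N, (g.coeff k : K) * (α - a) ^ k := by
    rw [Polynomial.aeval_eq_sum_range' (n := N)]
    · simp
    · rcases eq_or_ne g 0 with hg | hg
      -- The zero polynomial has `natDegree` 0, so only N = 0 could fail; then `hβ` would say v(p) =
      -- 1.
      · by_contra! h
        rw [hg] at h
        have hN : N = 0 := by simpa using h
        subst hN
        simp only [pow_zero] at hβ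
        exact hv.ne hβ.symm
      · exact (Polynomial.natDegree_lt_iff_degree_lt hg).mpr hgdeg
  have hdvd : ∀ k ∈ Finset.range N, (p : ℤ) ∣ g.coeff k := by
    refine v.dvd_of_map_sum_le hp h0 hv (y := fun k => (α - a) ^ k) (f := id) (N := N)
      (fun i hi => Finset.mem_range.mp hi) Function.injective_id.injOn (fun k _ => ?_) ?_
    · rw [map_pow, pow_right_comm, hβ, id]
    · rwa [← hgs, hge]
  have hgp : Polynomial.C (p : ℤ) ∣ g := by
    rw [Polynomial.C_dvd_iff_dvd_coeff]
    intro k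
    by_cases hk : k < N
    · exact hdvd k (Finset.mem_range.mpr hk)
    · rw [Polynomial.coeff_eq_zero_of_degree_lt (hgdeg.trans_le (by exact_mod_cast not_lt.mp hk))]
      exact dvd_zero _
  have hfp : Polynomial.C (p : ℤ) ∣ f := by
    have h1 := map_dvd (Polynomial.taylorAlgHom (-a)) hgp
    simpa [g, Polynomial.taylor_taylor] using h1
  intro k hk
  rw [← hfc k hk]
  exact (Polynomial.C_dvd_iff_dvd_coeff _ _).mp hfp k

end PureRadical

/-! ### The shifted root α - a at primes above p -/

theorem exists_add_pow_prime_eq_add_sq_mul {R : Type*} [CommRing R] {p : ℕ} (hp : p.Prime) (x y : R) :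
    ∃ w, (x + y) ^ p = x ^ p + y ^ p + p * (x * (y ^ (p - 1) + x * w)) := by
  have h2 := hp.two_le
  refine ⟨y * ∑ k ∈ Finset.Ioo 1 p, x ^ (k - 2) * y ^ (p - k - 1) * ↑(p.choose k / p), ?_⟩
  have hsplit : Finset.Ioo 0 p = insert 1 (Finset.Ioo 1 p) := by
    ext k
    simp only [Finset.mem_Ioo, Finset.mem_insert]
    omega
  have htail : ∑ k ∈ Finset.Ioo 1 p, x ^ (k - 1) * y ^ (p - k - 1) * ((p.choose k / p : ℕ) : R) =
      x * ∑ k ∈ Finset.Ioo 1 p, x ^ (k - 2) * y ^ (p - k - 1) * ((p.choose k / p : ℕ) : R) := by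
    rw [Finset.mul_sum]
    refine Finset.sum_congr rfl fun k hk => ?_
    rw [Finset.mem_Ioo] at hk
    rw [show k - 1 = k - 2 + 1 by omega, pow_succ]
    ring
  have hy : y ^ (p - 1) = y * y ^ (p - 1 - 1) := by
    rw [← pow_succ', show p - 1 - 1 + 1 = p - 1 by omega]
  rw [add_pow_prime_eq hp, hsplit, Finset.sum_insert (by simp), htail, Nat.choose_one_right,
    Nat.div_self hp.pos, hy]
  simp only [Nat.sub_self, pow_zero, Nat.cast_one]
  ring

section PureRadical

variable {K : Type*} [Field K] {p : ℕ} {a : ℤ} {α : K}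

/-- The binomial identity applied to α = (α - a) + a inside `𝓞 K`, which keeps w integral. -/
theorem exists_isIntegral_sub_pow_eq (hp : p.Prime) (hα : α ^ p = (a : K)) :
    ∃ w : K, IsIntegral ℤ w ∧ (α - a) ^ p =
      -(p * ((α - a) * ((a : K) ^ (p - 1) + (α - a) * w))) - ((a ^ p - a : ℤ) : K) := by
  let A : 𝓞 K := ⟨α, isIntegral_of_pow_eq hp.ne_zero hα⟩
  obtain ⟨w, hw⟩ := exists_add_pow_prime_eq_add_sq_mul hp (A - a) (a : 𝓞 K)
  refine ⟨w, w.isIntegral_coe, ?_⟩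
  have h := congrArg (algebraMap (𝓞 K) K) hw
  have hA : algebraMap (𝓞 K) K A = α := rfl
  simp only [sub_add_cancel, map_pow, map_add, map_mul, map_sub, map_natCast, map_intCast, hA,
    hα] at h
  push_cast
  linear_combination -h

section Valuation

variable {Γ₀ : Type*} [LinearOrderedCommGroupWithZero Γ₀] (v : Valuation K Γ₀)

/-- By Fermat's little theorem, (α - a)^p is p times an integral element. -/
theorem Valuation.sub_lt_one_of_pow_eq (hp : p.Prime) (hα : α ^ p = (a : K))
    (hv : v (p : K) < 1) : v (α - a) < 1 := by
  obtain ⟨w, hw, h⟩ := exists_isIntegral_sub_pow_eq hp hα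
  have hint : IsIntegral ℤ ((α - a) * ((a : K) ^ (p - 1) + (α - a) * w)) := by
    have ha : IsIntegral ℤ (a : K) := by
      simpa using isIntegral_algebraMap (R := ℤ) (A := K) (x := a)
    have hβ := (isIntegral_of_pow_eq hp.ne_zero hα).sub ha
    exact hβ.mul ((ha.pow _).add (hβ.mul hw))
  have hd : (p : ℤ) ∣ a ^ p - a := by
    have : Fact p.Prime := ⟨hp⟩
    rw [← ZMod.intCast_zmod_eq_zero_iff_dvd]
    simp
  refine (pow_lt_one_iff_of_nonneg zero_le hp.ne_zero).mp ?_
  rw [← map_pow, h]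
  refine (v.map_sub _ _).trans_lt (max_lt ?_ ?_)
  · rw [Valuation.map_neg, map_mul]
    exact mul_lt_one_of_nonneg_of_lt_one_left zero_le hv (v.le_one_of_isIntegral hint)
  · exact (v.intCast_le_of_dvd hd).trans_lt (by simpa using hv)

theorem Valuation.exists_sub_pow_eq (hp : p.Prime) (hpa : ¬ (p : ℤ) ∣ a) (hα : α ^ p = (a : K))
    (hv : v (p : K) < 1) :
    ∃ u : K, v u = 1 ∧ (α - a) ^ p = -(p * ((α - a) * u)) - ((a ^ p - a : ℤ) : K) := by
  obtain ⟨w, hw, h⟩ := exists_isIntegral_sub_pow_eq hp hα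
  refine ⟨_, ?_, h⟩
  have h1 : v ((a : K) ^ (p - 1)) = 1 := by
    rw [map_pow, v.intCast_eq_one_of_not_dvd hp hv hpa, one_pow]
  rw [v.map_add_eq_of_lt_left, h1]
  rw [h1, map_mul]
  exact mul_lt_one_of_nonneg_of_lt_one_left zero_le (v.sub_lt_one_of_pow_eq hp hα hv)
    (v.le_one_of_isIntegral hw)

/-- Here p divides a^p - a exactly once, so the constant term dominates pβu in the equation for β =
α - a. -/
theorem Valuation.sub_pow_eq_of_not_isWieferichPrime [CharZero K] (hp : p.Prime)
    (hpa : ¬ (p : ℤ) ∣ a) (hW : ¬ IsWieferichPrime p a) (hα : α ^ p = (a : K))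
    (hv : v (p : K) < 1) : v (α - a) ^ p = v (p : K) := by
  obtain ⟨u, hu, h⟩ := v.exists_sub_pow_eq hp hpa hα hv
  have h0 : 0 < v (p : K) := zero_lt_iff.mpr (v.ne_zero_iff.mpr (by exact_mod_cast hp.ne_zero))
  have hd : (p : ℤ) ∣ a ^ p - a := by
    have : Fact p.Prime := ⟨hp⟩
    rw [← ZMod.intCast_zmod_eq_zero_iff_dvd]
    simp
  obtain ⟨s, hs⟩ := hd
  have hps : ¬ (p : ℤ) ∣ s := by
    rintro ⟨c, rfl⟩
    refine hW ⟨hp, ?_⟩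
    have h1 : (p : ℤ) ^ 2 ∣ a * (a ^ (p - 1) - 1) := by
      refine ⟨c, ?_⟩
      rw [mul_sub, ← pow_succ', Nat.sub_add_cancel hp.one_le, mul_one, hs]
      ring
    exact (((Nat.prime_iff_prime_int.mp hp).coprime_iff_not_dvd.mpr hpa).pow_left).dvd_of_dvd_mul_left
      h1
  have hvs : v ((a ^ p - a : ℤ) : K) = v (p : K) := by
    rw [hs]
    push_cast
    rw [map_mul, v.intCast_eq_one_of_not_dvd hp hv hps, mul_one]
  rw [← map_pow, h, sub_eq_add_neg, v.map_add_eq_of_lt_right, Valuation.map_neg, hvs]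
  rw [Valuation.map_neg, Valuation.map_neg, hvs, map_mul, map_mul, hu, mul_one]
  exact mul_lt_of_lt_one_right h0 (v.sub_lt_one_of_pow_eq hp hα hv)

/-- Now v(a^p - a) ≤ v(p)². If v(β) > v(p), the term pβu dominates, and a factor v(β) cancels. -/
theorem Valuation.sub_le_or_pow_eq_of_isWieferichPrime [CharZero K] (hpa : ¬ (p : ℤ) ∣ a)
    (hW : IsWieferichPrime p a) (hα : α ^ p = (a : K)) (hv : v (p : K) < 1) :
    v (α - a) ≤ v (p : K) ∨ v (α - a) ^ (p - 1) = v (p : K) := by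
  obtain ⟨hp, hW⟩ := hW
  obtain ⟨u, hu, h⟩ := v.exists_sub_pow_eq hp hpa hα hv
  have h0 : 0 < v (p : K) := zero_lt_iff.mpr (v.ne_zero_iff.mpr (by exact_mod_cast hp.ne_zero))
  refine or_iff_not_imp_left.mpr fun hlt => ?_
  rw [not_le] at hlt
  have hvs : v ((a ^ p - a : ℤ) : K) ≤ v (p : K) * v (p : K) := by
    have hd : (p : ℤ) ^ 2 ∣ a ^ p - a := by
      have h1 : a ^ p - a = a * (a ^ (p - 1) - 1) := by
        rw [mul_sub, ← pow_succ', Nat.sub_add_cancel hp.one_le, mul_one]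
      rw [h1]
      exact hW.mul_left a
    simpa [pow_two] using v.intCast_le_of_dvd hd
  have hβ0 : v (α - a) ≠ 0 := (zero_le.trans_lt hlt).ne'
  have h1 : v (α - a) ^ p = v (p : K) * v (α - a) := by
    have h2 : v (-(p * ((α - a) * u))) = v (p : K) * v (α - a) := by
      rw [Valuation.map_neg, map_mul, map_mul, hu, mul_one]
    rw [← map_pow, h, sub_eq_add_neg, v.map_add_eq_of_lt_left, h2]
    rw [Valuation.map_neg, h2]
    exact hvs.trans_lt (mul_lt_mul_of_pos_left hlt h0)
  refine mul_right_cancel₀ hβ0 ?_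
  rw [← pow_succ, Nat.sub_add_cancel hp.one_le, h1]

end Valuation

variable [NumberField K]

theorem isIntegral_sub_pow_div (hpa : ¬ (p : ℤ) ∣ a)
    (hW : IsWieferichPrime p a) (hα : α ^ p = (a : K)) :
    IsIntegral ℤ ((α - a) ^ (p - 1) / p) := by
  have hp := hW.1
  have hp2 := hp.two_le
  refine isIntegral_of_valuation_le_one fun v => ?_
  have hβ : IsIntegral ℤ (α - a) := (isIntegral_of_pow_eq hp.ne_zero hα).sub
    (by simpa using isIntegral_algebraMap (R := ℤ) (A := K) (x := a))
  have hβ1 := (v.valuation K).le_one_of_isIntegral hβ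
  have h0 : 0 < v.valuation K (p : K) :=
    zero_lt_iff.mpr ((v.valuation K).ne_zero_iff.mpr (by exact_mod_cast hp.ne_zero))
  rw [map_div₀, map_pow, div_le_one₀ h0]
  have hv := (v.valuation K).intCast_le_one p
  rw [Int.cast_natCast] at hv
  rcases hv.lt_or_eq with hv | hv
  · rcases (v.valuation K).sub_le_or_pow_eq_of_isWieferichPrime hpa hW hα hv with h | h
    · exact (pow_le_of_le_one zero_le hβ1 (by omega)).trans h
    · exact h.le
  · rw [hv]
    exact pow_le_one₀ zero_le hβ1

/-- Only the constant binomial term has nonzero trace, and p - 1 is even. -/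
theorem trace_sub_pow (hp : p.Prime) (hodd : Odd p)
    (hirr : Irreducible (Polynomial.X ^ p - Polynomial.C a : Polynomial ℤ))
    (hα : α ^ p = (a : K)) (hK : IntermediateField.adjoin ℚ {α} = ⊤) :
    Algebra.trace ℚ K ((α - a) ^ (p - 1)) = p * (a : ℚ) ^ (p - 1) := by
  rw [sub_eq_add_neg, add_pow, map_sum, Finset.sum_eq_single 0]
  · have h : α ^ 0 * (-(a : K)) ^ (p - 1 - 0) * (((p - 1).choose 0 : ℕ) : K) =
        ((a ^ (p - 1) : ℤ) : K) := by
      rw [Nat.sub_zero, (Nat.Odd.sub_odd hodd odd_one).neg_pow]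
      simp
    rw [h, trace_intCast (finrank_of_pow_eq hp.ne_zero hirr hα hK)]
    push_cast
    rfl
  · intro k hk hk0
    rw [Finset.mem_range] at hk
    have h : α ^ k * (-(a : K)) ^ (p - 1 - k) * (((p - 1).choose k : ℕ) : K) =
        (((-a) ^ (p - 1 - k) * ((p - 1).choose k : ℤ) : ℤ) : K) * α ^ k := by
      push_cast
      ring
    have hp1 := hp.one_le
    rw [h, trace_intCast_mul, trace_pow_eq_zero hp.ne_zero hirr hα hK, mul_zero]
    exact fun hd => absurd (Nat.le_of_dvd (by omega) hd) (by omega)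
  · simp

/-- Otherwise β/p would be integral, and so would the trace p·a^(p-1)/p^(p-1) of its (p-1)-th power;
since p ≥ 3, this forces p ∣ a. -/
theorem exists_valuation_sub_pow_eq_of_isWieferichPrime (hodd : Odd p)
    (hpa : ¬ (p : ℤ) ∣ a) (hW : IsWieferichPrime p a)
    (hirr : Irreducible (Polynomial.X ^ p - Polynomial.C a : Polynomial ℤ))
    (hα : α ^ p = (a : K)) (hK : IntermediateField.adjoin ℚ {α} = ⊤) :
    ∃ v : HeightOneSpectrum (𝓞 K), v.valuation K (p : K) < 1 ∧
      v.valuation K (α - a) ^ (p - 1) = v.valuation K (p : K) := by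
  have hp := hW.1
  by_contra! hno
  have hδ : IsIntegral ℤ ((α - a) / p) := by
    refine isIntegral_of_valuation_le_one fun v => ?_
    have hβ : IsIntegral ℤ (α - a) := (isIntegral_of_pow_eq hp.ne_zero hα).sub
      (by simpa using isIntegral_algebraMap (R := ℤ) (A := K) (x := a))
    have h0 : 0 < v.valuation K (p : K) :=
      zero_lt_iff.mpr ((v.valuation K).ne_zero_iff.mpr (by exact_mod_cast hp.ne_zero))
    rw [map_div₀, div_le_one₀ h0]
    have hv := (v.valuation K).intCast_le_one p
    rw [Int.cast_natCast] at hv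
    rcases hv.lt_or_eq with hv | hv
    · exact ((v.valuation K).sub_le_or_pow_eq_of_isWieferichPrime hpa hW hα hv).resolve_right
        (hno v hv)
    · rw [hv]
      exact (v.valuation K).le_one_of_isIntegral hβ
  obtain ⟨n, hn⟩ := exists_intCast_eq_trace (hδ.pow (p - 1))
  have hp0 : (p : K) ≠ 0 := by exact_mod_cast hp.ne_zero
  have h1 : ((p ^ (p - 1) : ℤ) : K) * ((α - a) / p) ^ (p - 1) = (α - a) ^ (p - 1) := by
    push_cast
    rw [← mul_pow, mul_div_cancel₀ _ hp0]
  have h2 := trace_intCast_mul (p ^ (p - 1) : ℤ) (((α - a) / p) ^ (p - 1))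
  rw [h1, ← hn, trace_sub_pow hp hodd hirr hα hK] at h2
  have h3 : (p : ℤ) * a ^ (p - 1) = p ^ (p - 1) * n := by exact_mod_cast h2
  have hp3 : 3 ≤ p := by
    have := hp.two_le
    obtain ⟨c, rfl⟩ := hodd
    omega
  rw [show p - 1 = p - 3 + 1 + 1 by omega, pow_succ' (p : ℤ), mul_assoc] at h3
  have h4 := mul_left_cancel₀ (by exact_mod_cast hp.ne_zero) h3
  rw [pow_succ' (p : ℤ), mul_assoc] at h4
  exact hpa ((Nat.prime_iff_prime_int.mp hp).dvd_of_dvd_pow ⟨_, h4⟩)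

end PureRadical

/-! ### The elements b_k and the removal of denominators -/

section RadicalQuotient

variable {ι : Type*} [Fintype ι]

/-- The power `α ^ k` of a `p`-th root of `± ∏ q j ^ e j`, divided by the largest integer that
leaves an algebraic integer. -/
noncomputable def radicalQuotient {K : Type*} [Field K] (p : ℕ) (q e : ι → ℕ) (α : K) (k : ℕ) : K :=
  α ^ k / ∏ j, (q j : K) ^ (k * e j / p)

theorem mul_div_le_add_of_le {p k l : ℕ} (hp : 0 < p) (hkl : k ≤ l) (e : ℕ) :
    l * e / p ≤ k * e / p + (l - k) * e := by
  rw [← Nat.add_mul_div_left _ _ hp]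
  refine Nat.div_le_div_right ?_
  obtain ⟨d, rfl⟩ := Nat.exists_eq_add_of_le hkl
  rw [add_mul, Nat.add_sub_cancel_left]
  exact Nat.add_le_add_left (Nat.le_mul_of_pos_left _ hp) _

variable {K : Type*} [Field K] [NumberField K] {p : ℕ} {q e : ι → ℕ} {ε : ℤˣ} {a : ℤ} {α : K}

theorem prod_pow_ne_zero (hq : ∀ j, (q j).Prime) (f : ι → ℕ) : ∏ j, (q j : K) ^ f j ≠ 0 :=
  Finset.prod_ne_zero_iff.mpr fun j _ => pow_ne_zero _ (by exact_mod_cast (hq j).ne_zero)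

theorem pow_eq_mul_radicalQuotient (hq : ∀ j, (q j).Prime) (k : ℕ) :
    α ^ k = (∏ j, (q j : K) ^ (k * e j / p)) * radicalQuotient p q e α k := by
  rw [radicalQuotient, mul_div_cancel₀ _ (prod_pow_ne_zero hq _)]

theorem radicalQuotient_pow (hq : ∀ j, (q j).Prime) (ha : a = (ε : ℤ) * ∏ j, (q j : ℤ) ^ e j)
    (hα : α ^ p = (a : K)) (k : ℕ) :
    radicalQuotient p q e α k ^ p = (ε : ℤ) ^ k * ∏ j, (q j : K) ^ (k * e j % p) := by
  rw [radicalQuotient, div_pow, div_eq_iff (pow_ne_zero _ (prod_pow_ne_zero hq _)),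
    pow_right_comm, hα, ha, mul_assoc]
  push_cast
  rw [mul_pow, ← Finset.prod_pow, ← Finset.prod_pow, ← Finset.prod_mul_distrib]
  congr 1
  refine Finset.prod_congr rfl fun j _ => ?_
  rw [← pow_mul, ← pow_mul, ← pow_add, mul_comm (e j), mul_comm _ p, Nat.mod_add_div]

theorem isIntegral_radicalQuotient (hp : p ≠ 0) (hq : ∀ j, (q j).Prime)
    (ha : a = (ε : ℤ) * ∏ j, (q j : ℤ) ^ e j) (hα : α ^ p = (a : K)) (k : ℕ) :
    IsIntegral ℤ (radicalQuotient p q e α k) :=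
  isIntegral_of_pow_eq (a := (ε : ℤ) ^ k * ∏ j, (q j : ℤ) ^ (k * e j % p)) hp
    (by rw [radicalQuotient_pow hq ha hα]; push_cast; rfl)

theorem injOn_mul_mod (hp : p.Prime) {c : ℕ} (hc : 1 ≤ c ∧ c ≤ p - 1) :
    Set.InjOn (fun k => k * c % p) (Finset.range p : Set ℕ) := by
  intro k hk l hl h
  simp only [Finset.coe_range, Set.mem_Iio] at hk hl
  have h1 : k * c ≡ l * c [MOD p] := h
  have hp1 := hp.one_le
  have h2 : p.gcd c = 1 := (Nat.coprime_of_lt_prime (by omega) (by omega) hp)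
  have h3 := Nat.ModEq.cancel_right_of_coprime h2 h1
  rwa [Nat.ModEq, Nat.mod_eq_of_lt hk, Nat.mod_eq_of_lt hl] at h3

/-- At a prime above q_j, the p-th power of b_k has the valuation of q_j^(k e_j mod p); these
residues are distinct because e_j is prime to p. -/
theorem exists_sum_radicalQuotient_of_prime_mul (hp : p.Prime) (hq : ∀ j, (q j).Prime)
    (hqinj : Function.Injective q) (he : ∀ j, 1 ≤ e j ∧ e j ≤ p - 1)
    (ha : a = (ε : ℤ) * ∏ j, (q j : ℤ) ^ e j) (hα : α ^ p = (a : K)) (j : ι) {y : K}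
    (hy : IsIntegral ℤ y)
    (h : ∃ n : ℕ → ℤ, q j * y = ∑ k ∈ Finset.range p, (n k : K) * radicalQuotient p q e α k) :
    ∃ n : ℕ → ℤ, y = ∑ k ∈ Finset.range p, (n k : K) * radicalQuotient p q e α k := by
  obtain ⟨n, hn⟩ := h
  obtain ⟨w, hw⟩ := exists_valuation_lt_one (K := K) (hq j)
  set v := w.valuation K
  have hq0 : (q j : K) ≠ 0 := by exact_mod_cast (hq j).ne_zero
  have hdvd : ∀ k ∈ Finset.range p, (q j : ℤ) ∣ n k := by
    refine v.dvd_of_map_sum_le (hq j) (v.ne_zero_iff.mpr hq0) hw (N := p)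
      (y := radicalQuotient p q e α) (f := fun k => k * e j % p)
      (fun k _ => Nat.mod_lt _ hp.pos) (injOn_mul_mod hp (he j)) (fun k _ => ?_) ?_
    · have hε : v ((ε : ℤ) : K) = 1 := by
        refine v.intCast_eq_one_of_not_dvd (hq j) hw fun hd => ?_
        exact (Nat.prime_iff_prime_int.mp (hq j)).not_isUnit (isUnit_of_dvd_unit hd ε.isUnit)
      rw [← map_pow, radicalQuotient_pow hq ha hα, map_mul, map_pow, hε, one_pow, one_mul,
        map_prod, Finset.prod_eq_single j, map_pow]
      · intro i _ hij
        rw [map_pow, ← Int.cast_natCast (R := K) (q i),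
          v.intCast_eq_one_of_not_dvd (hq j) hw, one_pow]
        intro hd
        exact hij (hqinj ((Nat.prime_dvd_prime_iff_eq (hq j) (hq i)).mp
          (by exact_mod_cast hd)).symm)
      · simp
    · rw [← hn, map_mul]
      exact mul_le_of_le_one_right' (v.le_one_of_isIntegral hy)
  refine ⟨fun k => n k / q j, mul_left_cancel₀ hq0 ?_⟩
  rw [hn, Finset.mul_sum]
  refine Finset.sum_congr rfl fun k hk => ?_
  conv_lhs => rw [← Int.mul_ediv_cancel' (hdvd k hk)]
  push_cast
  ring

theorem exists_sum_radicalQuotient_of_prod_mul (hp : p.Prime) (hq : ∀ j, (q j).Prime)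
    (hqinj : Function.Injective q) (he : ∀ j, 1 ≤ e j ∧ e j ≤ p - 1)
    (ha : a = (ε : ℤ) * ∏ j, (q j : ℤ) ^ e j) (hα : α ^ p = (a : K)) (f : ι → ℕ) (s : Finset ι)
    {y : K} (hy : IsIntegral ℤ y)
    (h : ∃ n : ℕ → ℤ, (∏ j ∈ s, (q j : K) ^ f j) * y =
      ∑ k ∈ Finset.range p, (n k : K) * radicalQuotient p q e α k) :
    ∃ n : ℕ → ℤ, y = ∑ k ∈ Finset.range p, (n k : K) * radicalQuotient p q e α k := by
  classical
  have hqi : ∀ j, IsIntegral ℤ (q j : K) := fun j => by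
    simpa using isIntegral_algebraMap (R := ℤ) (A := K) (x := (q j : ℤ))
  induction s using Finset.induction_on generalizing y with
  | empty => simpa using h
  | insert j s hj ih =>
    rw [Finset.prod_insert hj, mul_comm ((q j : K) ^ f j), mul_assoc] at h
    have h1 := ih (((hqi j).pow _).mul hy) h
    clear h
    generalize f j = d at h1
    induction d with
    | zero => simpa using h1
    | succ c ihc =>
      rw [pow_succ', mul_assoc] at h1
      exact ihc (exists_sum_radicalQuotient_of_prime_mul hp hq hqinj he ha hα j
        (((hqi j).pow c).mul hy) h1)

theorem exists_prime_mul_eq_sum_radicalQuotient (hp : p.Prime) (hq : ∀ j, (q j).Prime)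
    (hqinj : Function.Injective q) (he : ∀ j, 1 ≤ e j ∧ e j ≤ p - 1)
    (ha : a = (ε : ℤ) * ∏ j, (q j : ℤ) ^ e j)
    (hirr : Irreducible (Polynomial.X ^ p - Polynomial.C a : Polynomial ℤ))
    (hα : α ^ p = (a : K)) (hK : IntermediateField.adjoin ℚ {α} = ⊤) {x : K}
    (hx : IsIntegral ℤ x) :
    ∃ n : ℕ → ℤ, p * x = ∑ k ∈ Finset.range p, (n k : K) * radicalQuotient p q e α k := by
  have hpi : IsIntegral ℤ (p : K) := by
    simpa using isIntegral_algebraMap (R := ℤ) (A := K) (x := (p : ℤ))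
  refine exists_sum_radicalQuotient_of_prod_mul hp hq hqinj he ha hα e Finset.univ (hpi.mul hx) ?_
  obtain ⟨n, hn⟩ := exists_prime_mul_eq_sum hp.ne_zero hirr hα hK hx
  -- The sign ε turns a into ∏ q_j^{e_j}, using ε² = 1; the product converts α^k into b_k.
  refine ⟨fun k => ε * (n k * ∏ j, (q j : ℤ) ^ (k * e j / p)), ?_⟩
  have hε : ((ε : ℤ) : K) * ((ε : ℤ) : K) = 1 := by
    have : (ε : ℤ) * (ε : ℤ) = 1 := by simp [← Units.val_mul]
    exact_mod_cast congrArg (Int.cast : ℤ → K) this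
  have h1 : (∏ j, (q j : K) ^ e j) * (p * x) = (ε : ℤ) * ((a : K) * (p * x)) := by
    rw [ha]
    push_cast
    linear_combination (-(∏ j, (q j : K) ^ e j) * (p * x)) * hε
  rw [h1, hn, Finset.mul_sum]
  refine Finset.sum_congr rfl fun k _ => ?_
  rw [pow_eq_mul_radicalQuotient (p := p) (e := e) hq k]
  push_cast
  ring

theorem not_dvd_prod_pow (hp : p.Prime) (hq : ∀ j, (q j).Prime) (hpq : ∀ j, p ≠ q j)
    (f : ι → ℕ) : ¬ (p : ℤ) ∣ ∏ j, (q j : ℤ) ^ f j := by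
  intro hd
  obtain ⟨j, -, hj⟩ := ((Nat.prime_iff_prime_int.mp hp).dvd_finsetProd_iff _).mp hd
  have h1 := (Nat.prime_iff_prime_int.mp hp).dvd_of_dvd_pow hj
  exact hpq j ((Nat.prime_dvd_prime_iff_eq hp (hq j)).mp (by exact_mod_cast h1))

theorem exists_sum_radicalQuotient_of_valuation {Γ₀ : Type*} [LinearOrderedCommGroupWithZero Γ₀]
    (v : Valuation K Γ₀) (hp : p.Prime) (hq : ∀ j, (q j).Prime) (hpq : ∀ j, p ≠ q j)
    (hv : v (p : K) < 1) {N : ℕ} (hN : N ≤ p) (hβ : v (α - a) ^ N = v (p : K)) {y : K}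
    (hy : IsIntegral ℤ y)
    (h : ∃ n : ℕ → ℤ, p * y = ∑ k ∈ Finset.range N, (n k : K) * radicalQuotient p q e α k) :
    ∃ n : ℕ → ℤ, y = ∑ k ∈ Finset.range N, (n k : K) * radicalQuotient p q e α k := by
  obtain ⟨n, hn⟩ := h
  have hp0 : (p : K) ≠ 0 := by exact_mod_cast hp.ne_zero
  let t : ℕ → ι → ℕ := fun k j => k * e j / p
  -- Multiplying by ∏ q_j^{t_(p-1)j} clears every denominator, since t_kj ≤ t_(p-1)j. The factors `c
  -- k` are prime to p, so passing to powers of α loses nothing.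
  let c : ℕ → ℤ := fun k => ∏ j, (q j : ℤ) ^ (t (p - 1) j - t k j)
  have hc : ∀ k < p, (∏ j, (q j : K) ^ t (p - 1) j) * radicalQuotient p q e α k =
      c k * α ^ k := by
    intro k hk
    rw [pow_eq_mul_radicalQuotient (p := p) (e := e) hq k, ← mul_assoc]
    congr 1
    simp only [c]
    push_cast
    rw [← Finset.prod_mul_distrib]
    refine Finset.prod_congr rfl fun j _ => ?_
    rw [← pow_add, Nat.sub_add_cancel]
    exact Nat.div_le_div_right (Nat.mul_le_mul_right _ (by omega))
  have hdvd : ∀ k < N, (p : ℤ) ∣ n k := by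
    intro k hk
    have h1 : ∀ k < N, (p : ℤ) ∣ n k * c k := by
      refine v.dvd_of_map_sum_pow_le (α := α) hp hv hβ ?_
      have h2 : ∑ k ∈ Finset.range N, ((n k * c k : ℤ) : K) * α ^ k =
          (∏ j, (q j : K) ^ t (p - 1) j) * (p * y) := by
        rw [hn, Finset.mul_sum]
        refine Finset.sum_congr rfl fun k hk => ?_
        rw [mul_left_comm, hc k ((Finset.mem_range.mp hk).trans_le hN)]
        push_cast
        ring
      have h3 : IsIntegral ℤ (∏ j, (q j : K) ^ t (p - 1) j) := by
        simpa using isIntegral_algebraMap (R := ℤ) (A := K)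
          (x := ∏ j, (q j : ℤ) ^ t (p - 1) j)
      rw [h2, mul_left_comm, map_mul]
      exact mul_le_of_le_one_right' (v.le_one_of_isIntegral (h3.mul hy))
    exact ((Nat.prime_iff_prime_int.mp hp).dvd_or_dvd (h1 k hk)).resolve_right
      (not_dvd_prod_pow hp hq hpq _)
  refine ⟨fun k => n k / p, mul_left_cancel₀ hp0 ?_⟩
  rw [hn, Finset.mul_sum]
  refine Finset.sum_congr rfl fun k hk => ?_
  conv_lhs => rw [← Int.mul_ediv_cancel' (hdvd k (Finset.mem_range.mp hk))]
  push_cast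
  ring

/-- In the binomial expansion, t_(p-1)j ≤ t_kj + (p-1-k)e_j makes each coefficient on b_k an
integer. The coefficient 1 on b_(p-1) lets this element replace it. -/
theorem exists_sub_pow_div_eq (hp : p.Prime) (hq : ∀ j, (q j).Prime)
    (ha : a = (ε : ℤ) * ∏ j, (q j : ℤ) ^ e j) :
    ∃ m : ℕ → ℤ, (α - a) ^ (p - 1) / ∏ j, (q j : K) ^ ((p - 1) * e j / p) =
      radicalQuotient p q e α (p - 1) +
        ∑ k ∈ Finset.range (p - 1), (m k : K) * radicalQuotient p q e α k := by
  let t : ℕ → ι → ℕ := fun k j => k * e j / p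
  refine ⟨fun k => (p - 1).choose k * (-ε : ℤ) ^ (p - 1 - k) *
    ∏ j, (q j : ℤ) ^ (t k j + (p - 1 - k) * e j - t (p - 1) j), ?_⟩
  rw [div_eq_iff (prod_pow_ne_zero hq _), add_mul, sub_eq_add_neg, add_pow,
    Finset.sum_range_succ, add_comm, mul_comm (radicalQuotient p q e α (p - 1)),
    ← pow_eq_mul_radicalQuotient hq, Finset.sum_mul]
  congr 1
  · simp
  refine Finset.sum_congr rfl fun k hk => ?_
  have hprod : (∏ j, (q j : K) ^ (t k j + (p - 1 - k) * e j - t (p - 1) j)) *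
      ∏ j, (q j : K) ^ t (p - 1) j =
      (∏ j, (q j : K) ^ t k j) * (∏ j, (q j : K) ^ e j) ^ (p - 1 - k) := by
    rw [← Finset.prod_pow, ← Finset.prod_mul_distrib, ← Finset.prod_mul_distrib]
    refine Finset.prod_congr rfl fun j _ => ?_
    rw [← pow_add, ← pow_mul, ← pow_add, Nat.sub_add_cancel, mul_comm (e j)]
    exact mul_div_le_add_of_le hp.pos (Finset.mem_range.mp hk).le _
  rw [pow_eq_mul_radicalQuotient (p := p) (e := e) hq k, ha]
  push_cast
  rw [← neg_mul, mul_pow]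
  linear_combination (-radicalQuotient p q e α k * ((p - 1).choose k : K) *
    (-((ε : ℤ) : K)) ^ (p - 1 - k)) * hprod

theorem isIntegral_sub_pow_div_prod (hpq : ∀ j, p ≠ q j) (hq : ∀ j, (q j).Prime)
    (ha : a = (ε : ℤ) * ∏ j, (q j : ℤ) ^ e j) (hpa : ¬ (p : ℤ) ∣ a) (hW : IsWieferichPrime p a)
    (hα : α ^ p = (a : K)) :
    IsIntegral ℤ ((α - a) ^ (p - 1) / ((p : K) * ∏ j, (q j : K) ^ ((p - 1) * e j / p))) := by
  have hp := hW.1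
  have hp0 : (p : K) ≠ 0 := by exact_mod_cast hp.ne_zero
  have hint : ∀ n : ℤ, IsIntegral ℤ (n : K) := fun n => by
    simpa using isIntegral_algebraMap (R := ℤ) (A := K) (x := n)
  obtain ⟨m, hm⟩ := exists_sub_pow_div_eq (α := α) hp hq ha
  have h1 : IsIntegral ℤ ((α - a) ^ (p - 1) / ∏ j, (q j : K) ^ ((p - 1) * e j / p)) := by
    rw [hm]
    have hb := isIntegral_radicalQuotient hp.ne_zero hq ha hα
    exact (hb _).add (IsIntegral.sum _ fun k _ => (hint _).mul (hb k))
  have h2 := isIntegral_sub_pow_div hpa hW hα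
  set Q : ℤ := ∏ j, (q j : ℤ) ^ ((p - 1) * e j / p) with hQ
  have hQK : ∏ j, (q j : K) ^ ((p - 1) * e j / p) = (Q : K) := by rw [hQ]; push_cast; rfl
  have hQ0 : (Q : K) ≠ 0 := hQK ▸ prod_pow_ne_zero hq _
  rw [hQK] at h1 ⊢
  -- Bézout for p and Q combines integrality of β^(p-1)/Q and of β^(p-1)/p.
  obtain ⟨x, y, hxy⟩ := (Nat.prime_iff_prime_int.mp hp).coprime_iff_not_dvd.mpr
    (not_dvd_prod_pow hp hq hpq fun j => (p - 1) * e j / p)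
  rw [← hQ] at hxy
  have hxy' : (x : K) * p + y * Q = 1 := by exact_mod_cast congrArg (Int.cast : ℤ → K) hxy
  have h3 : (α - a) ^ (p - 1) / ((p : K) * Q) =
      x * ((α - a) ^ (p - 1) / Q) + y * ((α - a) ^ (p - 1) / p) := by
    field_simp
    linear_combination (-(α - a) ^ (p - 1)) * hxy'
  rw [h3]
  exact ((hint x).mul h1).add ((hint y).mul h2)

theorem exists_basis_radicalQuotient (hp : p.Prime) (hq : ∀ j, (q j).Prime)
    (hqinj : Function.Injective q) (he : ∀ j, 1 ≤ e j ∧ e j ≤ p - 1)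
    (ha : a = (ε : ℤ) * ∏ j, (q j : ℤ) ^ e j)
    (hirr : Irreducible (Polynomial.X ^ p - Polynomial.C a : Polynomial ℤ))
    (hα : α ^ p = (a : K)) (hK : IntermediateField.adjoin ℚ {α} = ⊤)
    (hW : ¬ IsWieferichPrime p a) :
    ∃ b : Module.Basis (Fin p) ℤ (𝓞 K), ∀ k, (b k : K) = radicalQuotient p q e α k := by
  refine exists_basis_of_isIntegral_mem_span (finrank_of_pow_eq hp.ne_zero hirr hα hK)
    (b := fun k : Fin p => radicalQuotient p q e α k)
    (fun k => isIntegral_radicalQuotient hp.ne_zero hq ha hα k) fun x hx => ?_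
  have h := exists_prime_mul_eq_sum_radicalQuotient hp hq hqinj he ha hirr hα hK hx
  have hsum : ∃ n : ℕ → ℤ, x = ∑ k ∈ Finset.range p, (n k : K) * radicalQuotient p q e α k := by
    -- If p is one of the q_j, the remaining factor p is removed like any other q_j.
    by_cases hpq : ∃ j, p = q j
    · obtain ⟨j, hj⟩ := hpq
      exact exists_sum_radicalQuotient_of_prime_mul hp hq hqinj he ha hα j hx (hj ▸ h)
    · push Not at hpq
      have hpa : ¬ (p : ℤ) ∣ a := by
        rw [ha, (Units.isUnit ε).dvd_mul_left]
        exact not_dvd_prod_pow hp hq hpq _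
      obtain ⟨v, hv⟩ := exists_valuation_lt_one (K := K) hp
      exact exists_sum_radicalQuotient_of_valuation (v.valuation K) hp hq hpq hv le_rfl
        ((v.valuation K).sub_pow_eq_of_not_isWieferichPrime hp hpa hW hα hv) hx h
  obtain ⟨n, rfl⟩ := hsum
  rw [Finset.sum_range]
  refine Submodule.sum_mem _ fun k _ => ?_
  rw [← zsmul_eq_mul]
  exact Submodule.smul_mem _ _ (Submodule.subset_span ⟨k, rfl⟩)

theorem exists_basis_of_isWieferichPrime (hodd : Odd p) (hq : ∀ j, (q j).Prime)
    (hqinj : Function.Injective q) (he : ∀ j, 1 ≤ e j ∧ e j ≤ p - 1)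
    (ha : a = (ε : ℤ) * ∏ j, (q j : ℤ) ^ e j)
    (hirr : Irreducible (Polynomial.X ^ p - Polynomial.C a : Polynomial ℤ))
    (hα : α ^ p = (a : K)) (hK : IntermediateField.adjoin ℚ {α} = ⊤)
    (hW : IsWieferichPrime p a) :
    ∃ b : Module.Basis (Fin p) ℤ (𝓞 K), ∀ k : Fin p,
      (b k : K) = if (k : ℕ) = p - 1 then
        (α - a) ^ (p - 1) / ((p : K) * ∏ j, (q j : K) ^ ((p - 1) * e j / p))
      else radicalQuotient p q e α k := by
  have hp := hW.1
  have hp2 := hp.two_le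
  have hp0 : (p : K) ≠ 0 := by exact_mod_cast hp.ne_zero
  have hpa : ¬ (p : ℤ) ∣ a := by
    intro hd
    have h1 : (p : ℤ) ∣ a ^ (p - 1) - 1 := (Dvd.intro_left _ (pow_two (p : ℤ)).symm).trans hW.2
    have h2 : (p : ℤ) ∣ 1 := (dvd_sub_right (dvd_pow hd (by omega : p - 1 ≠ 0))).mp h1
    exact (Nat.prime_iff_prime_int.mp hp).not_isUnit (isUnit_of_dvd_one h2)
  have hpq : ∀ j, p ≠ q j := by
    intro j hj
    refine hpa ?_
    rw [ha, hj]
    exact ((dvd_pow_self _ (Nat.one_le_iff_ne_zero.mp (he j).1)).trans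
      (Finset.dvd_prod_of_mem (fun j => (q j : ℤ) ^ e j) (Finset.mem_univ j))).mul_left _
  set γ : K := (α - a) ^ (p - 1) / ((p : K) * ∏ j, (q j : K) ^ ((p - 1) * e j / p)) with hγ
  have hγi : IsIntegral ℤ γ := isIntegral_sub_pow_div_prod hpq hq ha hpa hW hα
  refine exists_basis_of_isIntegral_mem_span (finrank_of_pow_eq hp.ne_zero hirr hα hK)
    (b := fun k : Fin p => if (k : ℕ) = p - 1 then γ else radicalQuotient p q e α k)
    (fun k => ?_) fun x hx => ?_
  · split_ifs
    · exact hγi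
    · exact isIntegral_radicalQuotient hp.ne_zero hq ha hα k
  obtain ⟨n, hn⟩ := exists_prime_mul_eq_sum_radicalQuotient hp hq hqinj he ha hirr hα hK hx
  obtain ⟨m, hm⟩ := exists_sub_pow_div_eq (α := α) hp hq ha
  have hpγ : p * γ = radicalQuotient p q e α (p - 1) +
      ∑ k ∈ Finset.range (p - 1), (m k : K) * radicalQuotient p q e α k := by
    rw [← hm, hγ]
    field_simp
  obtain ⟨v, hv, hvβ⟩ := exists_valuation_sub_pow_eq_of_isWieferichPrime hodd hpa hW hirr hα hK
  have hy : IsIntegral ℤ (x - n (p - 1) * γ) := hx.sub (IsIntegral.mul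
    (by simpa using isIntegral_algebraMap (R := ℤ) (A := K) (x := n (p - 1))) hγi)
  -- Subtracting n_(p-1)·γ cancels the b_(p-1) term, leaving p - 1 terms, exactly the number that
  -- v(β)^(p-1) = v(p) can separate.
  obtain ⟨c, hc⟩ := exists_sum_radicalQuotient_of_valuation (e := e) (v.valuation K) hp hq hpq hv
    (Nat.sub_le p 1) hvβ hy ⟨fun k => n k - n (p - 1) * m k, by
      rw [← Nat.sub_add_cancel hp.one_le, Finset.sum_range_succ, Nat.sub_add_cancel hp.one_le] at hn
      rw [mul_sub, hn, mul_left_comm, hpγ, mul_add, add_comm (Finset.sum _ _), add_sub_add_left_eq_sub,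
        Finset.mul_sum, ← Finset.sum_sub_distrib]
      refine Finset.sum_congr rfl fun k _ => ?_
      push_cast
      ring⟩
  rw [sub_eq_iff_eq_add] at hc
  rw [hc]
  refine Submodule.add_mem _ (Submodule.sum_mem _ fun k hk => ?_) ?_
  · rw [Finset.mem_range] at hk
    rw [← zsmul_eq_mul]
    exact Submodule.smul_mem _ _ (Submodule.subset_span ⟨⟨k, by omega⟩, if_neg hk.ne⟩)
  · rw [← zsmul_eq_mul]
    exact Submodule.smul_mem _ _ (Submodule.subset_span ⟨⟨p - 1, by omega⟩, if_pos rfl⟩)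

theorem map_radicalQuotient_eq {L : Type*} [Field L] [Algebra K L] (hq : ∀ j, (q j).Prime)
    {α' : ι → L} (hα' : ∀ j, α' j ^ p = (q j : L))
    (h : algebraMap K L α = ((ε : ℤ) : L) * ∏ j, α' j ^ e j) (k : ℕ) :
    algebraMap K L (radicalQuotient p q e α k) =
      ((ε : ℤ) : L) ^ k * ∏ j, α' j ^ (k * e j % p) := by
  have h0 := (map_ne_zero (algebraMap K L)).mpr (prod_pow_ne_zero (K := K) hq fun j => k * e j / p)
  refine mul_left_cancel₀ h0 ?_
  rw [← map_mul, ← pow_eq_mul_radicalQuotient hq, map_pow, h, mul_pow, mul_left_comm]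
  congr 1
  rw [map_prod, ← Finset.prod_pow, ← Finset.prod_mul_distrib]
  refine Finset.prod_congr rfl fun j _ => ?_
  rw [map_pow, map_natCast, ← hα', ← pow_mul, ← pow_mul, ← pow_add, Nat.div_add_mod, mul_comm]

end RadicalQuotient

/-! ### Assembly, with t and e' the quotient and remainder of k·e_j by p -/

theorem proposition6p1
    (p : ℕ) (hp : p.Prime) (hodd : Odd p)
    -- the prime decomposition `a = ± ∏ q_j ^ e_j` with exponents between `1` and `p - 1`
    (m : ℕ) (q : Fin m → ℕ) (hq : ∀ j, (q j).Prime) (hqinj : Function.Injective q)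
    (e : Fin m → ℕ) (he : ∀ j, 1 ≤ e j ∧ e j ≤ p - 1)
    (ε : ℤˣ) (a : ℤ) (ha : a = (ε : ℤ) * ∏ j, (q j : ℤ) ^ e j)
    (hirr : Irreducible (Polynomial.X ^ p - Polynomial.C a : Polynomial ℤ))
    -- `K = ℚ(α)` with `α` a `p`-th root of `a`
    {K : Type*} [Field K] [NumberField K]
    (α : K) (hα : α ^ p = (a : K)) (hK : IntermediateField.adjoin ℚ {α} = ⊤) :
    ∃ t e' : ℕ → Fin m → ℕ,
      -- division with remainder, and the resulting algebraic integers
      ((∀ k ≤ p - 1, ∀ j, e' k j ≤ p - 1 ∧ k * e j = p * t k j + e' k j) ∧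
        (∀ k ≤ p - 1, IsIntegral ℤ (α ^ k / ∏ j, (q j : K) ^ t k j)) ∧
        (∀ (L : Type*) [Field L] [Algebra K L] (α' : Fin m → L),
          (∀ j, α' j ^ p = (q j : L)) →
          algebraMap K L α = ((ε : ℤ) : L) * ∏ j, α' j ^ e j →
          ∀ k ≤ p - 1, algebraMap K L (α ^ k / ∏ j, (q j : K) ^ t k j) =
            ((ε : ℤ) : L) ^ k * ∏ j, α' j ^ e' k j) ∧
        (∀ j, t 0 j = 0 ∧ e' 0 j = 0) ∧
        (∀ k, 1 ≤ k → k ≤ p - 1 → ∀ j, 1 ≤ e' k j)) ∧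
      -- monotonicity and growth of the quotients
      ((∀ k, 1 ≤ k → k ≤ p - 2 → ∀ j, t k j ≤ t (k + 1) j) ∧
        (∀ k, 1 ≤ k → k ≤ p - 1 → ∀ j,
          (t (p - 1) j : ℤ) - (t k j : ℤ) ≤ ((p : ℤ) - 1 - (k : ℤ)) * (e j : ℤ))) ∧
      -- non-Wieferich case
      (¬ IsWieferichPrime p a →
        ∃ b : Module.Basis (Fin p) ℤ (𝓞 K), ∀ k : Fin p,
          (b k : K) = α ^ (k : ℕ) / ∏ j, (q j : K) ^ t (k : ℕ) j) ∧
      -- Wieferich case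
      (IsWieferichPrime p a →
        ∃ b : Module.Basis (Fin p) ℤ (𝓞 K), ∀ k : Fin p,
          ((k : ℕ) ≤ p - 2 →
            (b k : K) = α ^ (k : ℕ) / ∏ j, (q j : K) ^ t (k : ℕ) j) ∧
          ((k : ℕ) = p - 1 →
            (b k : K) = (α - (a : K)) ^ (p - 1) / ((p : K) * ∏ j, (q j : K) ^ t (p - 1) j))) := by
  have hp1 := hp.one_le
  refine ⟨fun k j => k * e j / p, fun k j => k * e j % p, ⟨?_, ?_, ?_, ?_, ?_⟩, ⟨?_, ?_⟩, ?_, ?_⟩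
  · exact fun k _ j => ⟨Nat.le_sub_one_of_lt (Nat.mod_lt _ hp.pos), (Nat.div_add_mod _ _).symm⟩
  · exact fun k _ => isIntegral_radicalQuotient hp.ne_zero hq ha hα k
  · exact fun L _ _ α' hα' h k _ => map_radicalQuotient_eq hq hα' h k
  · simp
  · intro k hk1 hk2 j
    have hej := he j
    refine Nat.one_le_iff_ne_zero.mpr fun h => ?_
    rcases (hp.dvd_mul).mp (Nat.dvd_of_mod_eq_zero h) with hd | hd
    · exact absurd (Nat.le_of_dvd (by omega) hd) (by omega)
    · exact absurd (Nat.le_of_dvd (by omega) hd) (by omega)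
  · exact fun k _ _ j => Nat.div_le_div_right (Nat.mul_le_mul_right _ k.le_succ)
  · intro k _ hk j
    have h := mul_div_le_add_of_le hp.pos hk (e j)
    have h' : (((p - 1) * e j / p : ℕ) : ℤ) ≤
        ((k * e j / p : ℕ) : ℤ) + ((p - 1 - k : ℕ) : ℤ) * (e j : ℤ) := by exact_mod_cast h
    rw [Nat.cast_sub hk, Nat.cast_sub hp1, Nat.cast_one] at h'
    exact sub_le_iff_le_add'.mpr h'
  · exact exists_basis_radicalQuotient hp hq hqinj he ha hirr hα hK
  · intro hW
    obtain ⟨b, hb⟩ := exists_basis_of_isWieferichPrime hodd hq hqinj he ha hirr hα hK hW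
    have hp2 := hp.two_le
    refine ⟨b, fun k => ⟨fun hk => ?_, fun hk => ?_⟩⟩
    · rw [hb, if_neg (by omega), radicalQuotient]
    · rw [hb, if_pos hk]
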